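/- Let $c>0$, and let $\mathbb{CP}^2$ be the complex projective plane, regarded as a smooth real $4$-manifold, with the Fubini--Study metric $g_{FS}$ of constant holomorphic sectional curvature $c$, that is, the Riemannian metric with $$g_{FS}\big(d\pi_z(a),d\pi_z(b)\big)=\frac4c\,\mathrm{Re}\Big(\frac{\langle a,b\rangle}{|z|^2}-\frac{\langle a,z\rangle\langle z,b\rangle}{|z|^4}\Big)\qquad (z\in\mathbb C^3\setminus\{0\},\ a,b\in\mathbb C^3),$$ where $\langle\cdot,\cdot\rangle$ is the standard Hermitian product on $\mathbb C^3$ and $\pi:\mathbb C^3\setminus\{0\}\to\mathbb{CP}^2$ is the projection. Then no non-empty open subset $\mathcal U\subset\mathbb{CP}^2$ carries a system of orthogonal coordinates: there are no smooth local coordinates $x_1,x_2,x_3,x_4$ on $\mathcal U$ (a diffeomorphism of $\mathcal U$ onto an open subset of $\mathbb R^4$) such that $g_{FS}\big(\tfrac{\partial}{\partial x_i},\tfrac{\partial}{\partial x_j}\big)=0$ on $\mathcal U$ for all $i\ne j$. -/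

import Mathlib

open scoped LinearAlgebra.Projectivization Manifold ContDiff Bundle InnerProductSpace

noncomputable section

section Form

variable {V W : Type*} [NormedAddCommGroup V] [InnerProductSpace ℝ V]
  [NormedAddCommGroup W] [NormedSpace ℝ W]

/-- The inner product of a real inner product space as a bilinear form. -/
def realInner (V : Type*) [NormedAddCommGroup V] [InnerProductSpace ℝ V] : V →L[ℝ] V →L[ℝ] ℝ :=
  innerSL ℝ

@[simp] theorem realInner_apply (a b : V) : realInner V a b = inner ℝ a b := rfl

/-- The bilinear form `⟪a, b⟫ / |z|² - (⟪z, a⟫ ⟪z, b⟫ + ⟪J z, a⟫ ⟪J z, b⟫) / |z|⁴`. -/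
def horizontalForm (J : V →L[ℝ] V) (z : V) : V →L[ℝ] V →L[ℝ] ℝ :=
  (‖z‖ ^ 2)⁻¹ • realInner V -
    (‖z‖ ^ 4)⁻¹ • ((realInner V z).smulRight (realInner V z) +
      (realInner V (J z)).smulRight (realInner V (J z)))

theorem horizontalForm_apply (J : V →L[ℝ] V) (z a b : V) :
    horizontalForm J z a b = (‖z‖ ^ 2)⁻¹ * inner ℝ a b -
      (‖z‖ ^ 4)⁻¹ * (inner ℝ z a * inner ℝ z b + inner ℝ (J z) a * inner ℝ (J z) b) := by
  rfl

theorem contDiffAt_smul_aux {F : Type*} [NormedAddCommGroup F] [NormedSpace ℝ F] {f : W → ℝ}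
    {g : W → F} {w : W} (hf : ContDiffAt ℝ ∞ f w) (hg : ContDiffAt ℝ ∞ g w) :
    ContDiffAt ℝ ∞ (fun x => f x • g x) w :=
  hf.smul hg

theorem contDiffAt_horizontalForm (J : V →L[ℝ] V) {z : V} (hz : z ≠ 0) :
    ContDiffAt ℝ ∞ (horizontalForm J) z := by
  have h0 : ContDiffAt ℝ ∞ (fun z : V => ‖z‖) z := contDiffAt_norm ℝ hz
  have h1 : ContDiffAt ℝ ∞ (fun z : V => realInner V z) z := (realInner V).contDiff.contDiffAt
  have h2 : ContDiffAt ℝ ∞ (fun z : V => realInner V (J z)) z :=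
    ((realInner V).contDiff.comp J.contDiff).contDiffAt
  have h3 : ‖z‖ ≠ 0 := by simpa using hz
  unfold horizontalForm
  exact (contDiffAt_smul_aux ((h0.pow 2).inv (by positivity)) contDiffAt_const).sub
    (contDiffAt_smul_aux ((h0.pow 4).inv (by positivity))
      ((h1.smulRight h1).add (h2.smulRight h2)))

/-- The pullback `(u, v) ↦ B (L u) (L v)` of a bilinear form, multiplied by `r`. -/
def scaledPullback (r : ℝ) (L : W →L[ℝ] V) (B : V →L[ℝ] V →L[ℝ] ℝ) : W →L[ℝ] W →L[ℝ] ℝ :=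
  r • B.bilinearComp L L

@[simp] theorem scaledPullback_apply (r : ℝ) (L : W →L[ℝ] V) (B : V →L[ℝ] V →L[ℝ] ℝ) (u v : W) :
    scaledPullback r L B u v = r * B (L u) (L v) := by
  simp [scaledPullback]

theorem contDiffAt_scaledPullback (r : ℝ) (L : W →L[ℝ] V) (J : V →L[ℝ] V) {f : W → V} {w : W}
    (hf : ContDiffAt ℝ ∞ f w) (h0 : f w ≠ 0) :
    ContDiffAt ℝ ∞ (fun x => scaledPullback r L (horizontalForm J (f x))) w := by
  have h := (contDiffAt_horizontalForm J h0).comp w hf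
  have h' : ContDiffAt ℝ ∞ (fun x => r • ((ContinuousLinearMap.compL ℝ W V ℝ).flip L ∘L
      (horizontalForm J (f x) ∘L L))) w :=
    (contDiffAt_const.clm_comp (h.clm_comp contDiffAt_const)).const_smul r
  exact h'

/-- A positive definite form on a finite-dimensional space has bounded unit ball. -/
theorem isVonNBounded_of_pos [FiniteDimensional ℝ W] (B : W →L[ℝ] W →L[ℝ] ℝ)
    (hpos : ∀ v, v ≠ 0 → 0 < B v v) : Bornology.IsVonNBounded ℝ {v : W | B v v < 1} := by
  rw [NormedSpace.isVonNBounded_iff, isBounded_iff_forall_norm_le]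
  rcases subsingleton_or_nontrivial W with hW | hW
  · exact ⟨0, fun x _ => by simp [Subsingleton.elim x 0]⟩
  have : ProperSpace W := FiniteDimensional.proper_real W
  have hc : Continuous fun v : W => B v v := by fun_prop
  obtain ⟨x, hx, hmin⟩ := (isCompact_sphere (0 : W) 1).exists_isMinOn
    (NormedSpace.sphere_nonempty.2 zero_le_one) hc.continuousOn
  have hx0 : x ≠ 0 := by rintro rfl; simp at hx
  have hk := hpos x hx0
  refine ⟨√(B x x)⁻¹, fun v hv => ?_⟩
  rcases eq_or_ne v 0 with rfl | hv0
  · simp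
  have hn : 0 < ‖v‖ := norm_pos_iff.2 hv0
  have h1 : B x x ≤ B (‖v‖⁻¹ • v) (‖v‖⁻¹ • v) := hmin (by simp [norm_smul, hn.ne'])
  have h2 : B v v < 1 := hv
  apply Real.le_sqrt_of_sq_le
  simp only [map_smul, smul_apply, smul_eq_mul] at h1
  rw [← mul_assoc, ← mul_inv, ← pow_two] at h1
  rw [le_inv_comm₀ (by positivity) hk]
  calc B x x ≤ (‖v‖ ^ 2)⁻¹ * B v v := h1
    _ ≤ (‖v‖ ^ 2)⁻¹ * 1 := by gcongr
    _ = _ := mul_one _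

end Form

/-- Complex projective space of complex dimension `m`: the complex lines in `ℂ^(m+1)`. -/
abbrev CP (m : ℕ) : Type := ℙ ℂ (EuclideanSpace ℂ (Fin (m + 1)))

namespace CP

variable {m : ℕ}

/-- The quotient topology of `ℂ^(m+1) \ {0} → CP m`. -/
instance instTopologicalSpace : TopologicalSpace (CP m) :=
  TopologicalSpace.coinduced
    (Projectivization.mk' ℂ : {v : EuclideanSpace ℂ (Fin (m + 1)) // v ≠ 0} → CP m) inferInstance

theorem isQuotientMap_mk' : Topology.IsQuotientMap
    (Projectivization.mk' ℂ : {v : EuclideanSpace ℂ (Fin (m + 1)) // v ≠ 0} → CP m) :=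
  ⟨⟨rfl⟩, Quotient.mk''_surjective⟩

/-- The linear inclusion `ℂ^m → ℂ^(m+1)` that inserts `0` at the index `i`. -/
def incl (i : Fin (m + 1)) : EuclideanSpace ℂ (Fin m) →L[ℝ] EuclideanSpace ℂ (Fin (m + 1)) :=
  LinearMap.toContinuousLinearMap
    { toFun := fun u => WithLp.toLp 2 (i.insertNth (α := fun _ => ℂ) 0 u)
      map_add' := fun u v => by
        ext k; rcases Fin.eq_self_or_eq_succAbove i k with rfl | ⟨j, rfl⟩ <;> simp
      map_smul' := fun c u => by
        ext k; rcases Fin.eq_self_or_eq_succAbove i k with rfl | ⟨j, rfl⟩ <;> simp }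

@[simp] theorem incl_self (i : Fin (m + 1)) (u : EuclideanSpace ℂ (Fin m)) : incl i u i = 0 := by
  simp [incl]

@[simp] theorem incl_succAbove (i : Fin (m + 1)) (u : EuclideanSpace ℂ (Fin m)) (j : Fin m) :
    incl i u (i.succAbove j) = u j := by
  simp [incl]

/-- The affine lift `ℂ^m → ℂ^(m+1)` that inserts `1` at the index `i`. -/
def aff (i : Fin (m + 1)) (w : EuclideanSpace ℂ (Fin m)) : EuclideanSpace ℂ (Fin (m + 1)) :=
  EuclideanSpace.single i 1 + incl i w

@[simp] theorem aff_self (i : Fin (m + 1)) (u : EuclideanSpace ℂ (Fin m)) : aff i u i = 1 := by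
  simp [aff]

@[simp] theorem aff_succAbove (i : Fin (m + 1)) (u : EuclideanSpace ℂ (Fin m)) (j : Fin m) :
    aff i u (i.succAbove j) = u j := by
  simp [aff]

theorem aff_ne_zero (i : Fin (m + 1)) (w : EuclideanSpace ℂ (Fin m)) : aff i w ≠ 0 := fun h => by
  simpa using congrArg (fun v => v i) h

/-- The quotients `z_k / z_i`, `k ≠ i`. -/
def ratio (i : Fin (m + 1)) (z : EuclideanSpace ℂ (Fin (m + 1))) : EuclideanSpace ℂ (Fin m) :=
  WithLp.toLp 2 fun j => z (i.succAbove j) / z i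

@[simp] theorem ratio_apply (i : Fin (m + 1)) (z : EuclideanSpace ℂ (Fin (m + 1))) (j : Fin m) :
    ratio i z j = z (i.succAbove j) / z i := rfl

theorem ratio_smul (i : Fin (m + 1)) (z : EuclideanSpace ℂ (Fin (m + 1))) {t : ℂ} (ht : t ≠ 0) :
    ratio i (t • z) = ratio i z := by
  ext j
  simp [mul_div_mul_left _ _ ht]

theorem ne_zero_of_smul {a b : {v : EuclideanSpace ℂ (Fin (m + 1)) // v ≠ 0}} {t : ℂ}
    (h : (a : EuclideanSpace ℂ (Fin (m + 1))) = t • (b : EuclideanSpace ℂ (Fin (m + 1)))) :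
    t ≠ 0 := by
  rintro rfl
  exact a.2 (by simpa using h)

theorem aff_ratio (i : Fin (m + 1)) (z : EuclideanSpace ℂ (Fin (m + 1))) (hz : z i ≠ 0) :
    aff i (ratio i z) = (z i)⁻¹ • z := by
  ext k
  rcases Fin.eq_self_or_eq_succAbove i k with rfl | ⟨j, rfl⟩
  · simp [hz]
  · simp [div_eq_inv_mul]

theorem contDiff_aff (i : Fin (m + 1)) : ContDiff ℝ ∞ (aff i) := by
  unfold aff; fun_prop

theorem contDiffAt_ratio (i : Fin (m + 1)) {z : EuclideanSpace ℂ (Fin (m + 1))} (hz : z i ≠ 0) :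
    ContDiffAt ℝ ∞ (ratio i) z := by
  rw [contDiffAt_piLp 2]
  intro j
  have h (k : Fin (m + 1)) :
      ContDiffAt ℝ ∞ (fun z : EuclideanSpace ℂ (Fin (m + 1)) => z k) z := by fun_prop
  simp only [ratio_apply, div_eq_mul_inv]
  exact (h (i.succAbove j)).mul ((h i).inv hz)

/-- The affine chart `[z] ↦ (z_k / z_i)_{k ≠ i}`, defined where `z_i ≠ 0`. -/
def affineChart (i : Fin (m + 1)) : OpenPartialHomeomorph (CP m) (EuclideanSpace ℂ (Fin m)) where
  toFun := Projectivization.lift (fun v => ratio i v)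
    fun a b t h => by rw [h, ratio_smul i _ (ne_zero_of_smul h)]
  invFun w := Projectivization.mk ℂ (aff i w) (aff_ne_zero i w)
  source := {p | Projectivization.lift (fun v => (v : EuclideanSpace ℂ (Fin (m + 1))) i ≠ 0)
    (fun a b t h => by simp [h, ne_zero_of_smul h]) p}
  target := Set.univ
  map_source' _ _ := Set.mem_univ _
  map_target' w _ := by simp
  left_inv' p := by
    induction p using Projectivization.ind with
    | h v hv =>
      intro h
      have h : v i ≠ 0 := h
      simp only [Projectivization.lift_mk]
      rw [Projectivization.mk_eq_mk_iff']
      exact ⟨(v i)⁻¹, (aff_ratio i v h).symm⟩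
  right_inv' w _ := by ext j; simp
  open_source := by
    rw [← isQuotientMap_mk'.isOpen_preimage]
    have : Continuous fun v : {v : EuclideanSpace ℂ (Fin (m + 1)) // v ≠ 0} =>
      (v : EuclideanSpace ℂ (Fin (m + 1))) i := by fun_prop
    exact isOpen_ne.preimage this
  open_target := isOpen_univ
  continuousOn_toFun := by
    have ho : IsOpen {p : CP m | Projectivization.lift
        (fun v => (v : EuclideanSpace ℂ (Fin (m + 1))) i ≠ 0)
        (fun a b t h => by simp [h, ne_zero_of_smul h]) p} := by
      rw [← isQuotientMap_mk'.isOpen_preimage]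
      have : Continuous fun v : {v : EuclideanSpace ℂ (Fin (m + 1)) // v ≠ 0} =>
        (v : EuclideanSpace ℂ (Fin (m + 1))) i := by fun_prop
      exact isOpen_ne.preimage this
    rw [isQuotientMap_mk'.continuousOn_isOpen_iff ho]
    intro v hv
    exact ((contDiffAt_ratio i (z := v) hv).continuousAt.comp
      continuous_subtype_val.continuousAt).continuousWithinAt
  continuousOn_invFun := by
    apply Continuous.continuousOn
    have : Continuous fun w : EuclideanSpace ℂ (Fin m) =>
        (⟨aff i w, aff_ne_zero i w⟩ : {v : EuclideanSpace ℂ (Fin (m + 1)) // v ≠ 0}) :=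
      (contDiff_aff i).continuous.subtype_mk _
    exact isQuotientMap_mk'.continuous.comp this

@[simp] theorem affineChart_mk (i : Fin (m + 1)) (z : EuclideanSpace ℂ (Fin (m + 1)))
    (hz : z ≠ 0) : affineChart i (Projectivization.mk ℂ z hz) = ratio i z := rfl

@[simp] theorem affineChart_symm (i : Fin (m + 1)) (w : EuclideanSpace ℂ (Fin m)) :
    (affineChart i).symm w = Projectivization.mk ℂ (aff i w) (aff_ne_zero i w) := rfl

@[simp] theorem mk_mem_affineChart_source (i : Fin (m + 1)) (z : EuclideanSpace ℂ (Fin (m + 1)))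
    (hz : z ≠ 0) : Projectivization.mk ℂ z hz ∈ (affineChart i).source ↔ z i ≠ 0 := Iff.rfl

@[simp] theorem affineChart_target (i : Fin (m + 1)) :
    (affineChart (m := m) i).target = Set.univ := rfl

theorem exists_mem_affineChart_source (p : CP m) : ∃ i, p ∈ (affineChart i).source := by
  induction p using Projectivization.ind with
  | h v hv =>
    by_contra! h
    exact hv (by ext i; simpa using h i)

/-- The index of the preferred affine chart at `p`. -/
def idx (p : CP m) : Fin (m + 1) := (exists_mem_affineChart_source p).choose

theorem mem_idx_source (p : CP m) : p ∈ (affineChart (idx p)).source :=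
  (exists_mem_affineChart_source p).choose_spec

/-- The atlas of the `m + 1` affine charts. -/
instance instChartedSpace : ChartedSpace (EuclideanSpace ℂ (Fin m)) (CP m) where
  atlas := Set.range affineChart
  chartAt p := affineChart (idx p)
  mem_chart_source := mem_idx_source
  chart_mem_atlas p := ⟨idx p, rfl⟩

theorem chartAt_eq (p : CP m) : chartAt (EuclideanSpace ℂ (Fin m)) p = affineChart (idx p) := rfl

/-- `CP m` is a smooth real manifold, modelled on `ℂ^m = ℝ^(2m)`. -/
instance instIsManifold : IsManifold 𝓘(ℝ, EuclideanSpace ℂ (Fin m)) ∞ (CP m) := by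
  apply isManifold_of_contDiffOn
  rintro _ _ ⟨i, rfl⟩ ⟨j, rfl⟩
  intro w hw
  have hw' : aff i w j ≠ 0 := by simpa using hw
  exact ((contDiffAt_ratio j hw').comp w (contDiff_aff i).contDiffAt).contDiffWithinAt

/-- The real part of the hermitian form `⟪a, b⟫ / |z|² - ⟪a, z⟫ ⟪z, b⟫ / |z|⁴` on `ℂ^(m+1)`, see
`fsForm_apply`: the inner product of the components of `a / |z|` and `b / |z|` orthogonal to the
complex line `ℂ z`. -/
def fsForm (z : EuclideanSpace ℂ (Fin (m + 1))) :
    EuclideanSpace ℂ (Fin (m + 1)) →L[ℝ] EuclideanSpace ℂ (Fin (m + 1)) →L[ℝ] ℝ :=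
  horizontalForm (Complex.I • ContinuousLinearMap.id ℝ (EuclideanSpace ℂ (Fin (m + 1)))) z

theorem real_inner_eq (a b : EuclideanSpace ℂ (Fin (m + 1))) :
    inner ℝ a b = (inner ℂ a b).re := by
  simp [PiLp.inner_apply, Complex.inner, mul_comm]

theorem fsForm_apply (z a b : EuclideanSpace ℂ (Fin (m + 1))) :
    fsForm z a b = (inner ℂ a b / ‖z‖ ^ 2 - inner ℂ a z * inner ℂ z b / ‖z‖ ^ 4 : ℂ).re := by
  have h1 : (inner ℂ a b / ‖z‖ ^ 2 : ℂ).re = (inner ℂ a b).re / ‖z‖ ^ 2 := by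
    rw [← Complex.ofReal_pow, Complex.div_ofReal_re]
  have h2 : (inner ℂ a z * inner ℂ z b / ‖z‖ ^ 4 : ℂ).re
      = (inner ℂ a z * inner ℂ z b).re / ‖z‖ ^ 4 := by
    rw [← Complex.ofReal_pow, Complex.div_ofReal_re]
  rw [Complex.sub_re, h1, h2]
  have h3 : inner ℂ a z = (starRingEnd ℂ) (inner ℂ z a) := (inner_conj_symm _ _).symm
  rw [fsForm, horizontalForm_apply]
  rw [real_inner_eq, real_inner_eq, real_inner_eq, real_inner_eq, real_inner_eq, h3]
  simp only [smul_apply, ContinuousLinearMap.coe_id', id_eq, inner_smul_left, Complex.conj_I,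
    Complex.mul_re, Complex.conj_re, Complex.conj_im, Complex.neg_re, Complex.neg_im, Complex.I_re,
    Complex.I_im]
  ring

theorem fsForm_symm (z a b : EuclideanSpace ℂ (Fin (m + 1))) : fsForm z a b = fsForm z b a := by
  rw [fsForm, horizontalForm_apply, horizontalForm_apply, real_inner_comm]
  ring

/-- The form is invariant under rescaling the lift and under adding multiples of `z`. -/
theorem fsForm_smul_add {z : EuclideanSpace ℂ (Fin (m + 1))} (hz : z ≠ 0) {t : ℂ} (ht : t ≠ 0)
    (a b : EuclideanSpace ℂ (Fin (m + 1))) (r s : ℂ) :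
    fsForm (t • z) (t • a + r • z) (t • b + s • z) = fsForm z a b := by
  have hz' : (‖z‖ : ℂ) ≠ 0 := by simpa using hz
  have ht' : (‖t‖ : ℂ) ≠ 0 := by simpa using ht
  rw [fsForm_apply, fsForm_apply]
  congr 1
  have h : (starRingEnd ℂ) t * t = (‖t‖ : ℂ) ^ 2 := Complex.conj_mul' t
  have hzz : inner ℂ z z = (‖z‖ : ℂ) ^ 2 := inner_self_eq_norm_sq_to_K z
  simp only [norm_smul, inner_smul_left, inner_smul_right, inner_add_left, inner_add_right, hzz,
    Complex.ofReal_mul]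
  field_simp
  linear_combination (inner ℂ a b * ‖z‖ ^ 2 * ‖t‖ ^ 2 
    - (inner ℂ a z * inner ℂ z b) * (‖t‖ ^ 2 + (starRingEnd ℂ) t * t)
    - ‖z‖ ^ 2 * (starRingEnd ℂ) t * s * inner ℂ a z
    - ‖z‖ ^ 2 * t * (starRingEnd ℂ) r * inner ℂ z b - ‖z‖ ^ 4 * (starRingEnd ℂ) r * s) * h

theorem fsForm_incl_pos (i : Fin (m + 1)) (w u : EuclideanSpace ℂ (Fin m)) (hu : u ≠ 0) :
    0 < fsForm (aff i w) (incl i u) (incl i u) := by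
  have hu' : incl i u ≠ 0 := fun h => hu (by ext j; simp [← incl_succAbove i u j, h])
  have hz := aff_ne_zero i w
  have hne : ‖inner ℂ (incl i u) (aff i w)‖ ≠ ‖incl i u‖ * ‖aff i w‖ := by
    rw [Ne, norm_inner_eq_norm_iff hu' hz]
    rintro ⟨r, -, h⟩
    simpa using congrArg (fun v => v i) h
  have hlt := lt_of_le_of_ne (norm_inner_le_norm (𝕜 := ℂ) (incl i u) (aff i w)) hne
  generalize incl i u = a at *
  generalize aff i w = z at *
  have hz' : 0 < ‖z‖ := by simpa using hz
  have h1 : (inner ℂ a a : ℂ) = (‖a‖ : ℂ) ^ 2 := inner_self_eq_norm_sq_to_K a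
  have h2 : inner ℂ a z * inner ℂ z a = (‖inner ℂ a z‖ : ℂ) ^ 2 := by
    rw [← inner_conj_symm z a, Complex.mul_conj']
  rw [fsForm_apply, h1, h2]
  have h3 : ((‖a‖ : ℂ) ^ 2 / (‖z‖ : ℂ) ^ 2 - (‖inner ℂ a z‖ : ℂ) ^ 2 / (‖z‖ : ℂ) ^ 4).re
      = ‖a‖ ^ 2 / ‖z‖ ^ 2 - ‖inner ℂ a z‖ ^ 2 / ‖z‖ ^ 4 := by
    exact_mod_cast rfl
  rw [h3, sub_pos, div_lt_div_iff₀ (by positivity) (by positivity)]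
  have h4 : ‖inner ℂ a z‖ ^ 2 < (‖a‖ * ‖z‖) ^ 2 :=
    pow_lt_pow_left₀ hlt (norm_nonneg _) two_ne_zero
  nlinarith [mul_lt_mul_of_pos_right h4 (show 0 < ‖z‖ ^ 2 by positivity)]

theorem hasFDerivAt_aff (i : Fin (m + 1)) (w : EuclideanSpace ℂ (Fin m)) :
    HasFDerivAt (aff i) (incl i) w :=
  (incl i).hasFDerivAt.const_add _

/-- The forms pulled back to two affine charts are related by the derivative of the transition. -/
theorem fsForm_transition (i j : Fin (m + 1)) (w : EuclideanSpace ℂ (Fin m)) (hw : aff j w i ≠ 0)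
    (T : EuclideanSpace ℂ (Fin m) →L[ℝ] EuclideanSpace ℂ (Fin m))
    (hT : HasFDerivAt (fun x => ratio i (aff j x)) T w) (u v : EuclideanSpace ℂ (Fin m)) :
    fsForm (aff i (ratio i (aff j w))) (incl i (T u)) (incl i (T v)) =
      fsForm (aff j w) (incl j u) (incl j v) := by
  have hi : HasFDerivAt (fun x => aff j x i)
      ((EuclideanSpace.proj i : EuclideanSpace ℂ (Fin (m + 1)) →L[ℂ] ℂ).restrictScalars ℝ ∘L
        incl j) w :=
    ((EuclideanSpace.proj i : EuclideanSpace ℂ (Fin (m + 1)) →L[ℂ] ℂ).restrictScalars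
      ℝ).hasFDerivAt.comp w (hasFDerivAt_aff j w)
  have hd : DifferentiableAt ℝ (fun x => (aff j x i)⁻¹) w := hi.differentiableAt.inv hw
  have h1 : HasFDerivAt (fun x => aff i (ratio i (aff j x))) (incl i ∘L T) w :=
    (hasFDerivAt_aff i _).comp w hT
  have h2 := hd.hasFDerivAt.smul (hasFDerivAt_aff j w)
  have h3 : (fun x => aff i (ratio i (aff j x))) =ᶠ[nhds w] fun x => (aff j x i)⁻¹ • aff j x := by
    filter_upwards [hi.continuousAt.eventually_ne hw] with x hx using aff_ratio i _ hx
  have h4 := h1.unique (h2.congr_of_eventuallyEq h3)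
  have h5 (u : EuclideanSpace ℂ (Fin m)) : incl i (T u) = (aff j w i)⁻¹ • incl j u +
      (fderiv ℝ (fun x => (aff j x i)⁻¹) w u) • aff j w := by
    have := congrArg (fun L => L u) h4
    simpa using this
  rw [h5, h5, aff_ratio i _ hw, fsForm_smul_add (aff_ne_zero j w) (inv_ne_zero hw)]

/-- The Fubini–Study inner product on the tangent space at `p`. Mathlib's tangent space at `p` is
`ℂ^m` through the preferred affine chart at `p`, whose inverse `w ↦ [aff i w]` lifts to
`w ↦ aff i w` in `ℂ^(m+1) \ {0}` with derivative `incl i`; the inner product is `4 / c` times the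
form `fsForm` of the lifted vectors. -/
def fsInner (c : ℝ) (p : CP m) : TangentSpace 𝓘(ℝ, EuclideanSpace ℂ (Fin m)) p →L[ℝ]
    TangentSpace 𝓘(ℝ, EuclideanSpace ℂ (Fin m)) p →L[ℝ] ℝ :=
  (scaledPullback (4 / c) (incl (idx p)) (fsForm (aff (idx p) (affineChart (idx p) p))) :
    EuclideanSpace ℂ (Fin m) →L[ℝ] EuclideanSpace ℂ (Fin m) →L[ℝ] ℝ)

theorem fsInner_apply (c : ℝ) (p : CP m) (u v : EuclideanSpace ℂ (Fin m)) :
    fsInner c p u v = 4 / c *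
      fsForm (aff (idx p) (affineChart (idx p) p)) (incl (idx p) u) (incl (idx p) v) :=
  scaledPullback_apply (W := EuclideanSpace ℂ (Fin m)) _ _ _ _ _

/-- The inner product computed in any preferred chart. -/
theorem fsInner_tangentCoordChange (c : ℝ) (p₀ p : CP m)
    (hp : p ∈ (affineChart (idx p₀)).source) (u v : EuclideanSpace ℂ (Fin m)) :
    fsInner c p (tangentCoordChange 𝓘(ℝ, EuclideanSpace ℂ (Fin m)) p₀ p p u)
      (tangentCoordChange 𝓘(ℝ, EuclideanSpace ℂ (Fin m)) p₀ p p v) = 4 / c *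
      fsForm (aff (idx p₀) (affineChart (idx p₀) p)) (incl (idx p₀) u) (incl (idx p₀) v) := by
  have hT := hasFDerivWithinAt_tangentCoordChange (I := 𝓘(ℝ, EuclideanSpace ℂ (Fin m)))
    (x := p₀) (y := p) (z := p) ⟨by simpa [chartAt_eq] using hp, mem_extChartAt_source p⟩
  rw [modelWithCornersSelf_coe, Set.range_id, hasFDerivWithinAt_univ] at hT
  have hq : (affineChart (idx p₀)).symm (affineChart (idx p₀) p) = p :=
    (affineChart (idx p₀)).left_inv hp
  have hw : aff (idx p₀) (affineChart (idx p₀) p) (idx p) ≠ 0 := by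
    have h := mem_idx_source p
    rw [← mk_mem_affineChart_source (idx p) _ (aff_ne_zero _ _), ← affineChart_symm, hq]
    exact h
  have hr : affineChart (idx p) p = ratio (idx p) (aff (idx p₀) (affineChart (idx p₀) p)) := by
    rw [← affineChart_mk (idx p) _ (aff_ne_zero _ _), ← affineChart_symm, hq]
  rw [fsInner_apply, hr, fsForm_transition (idx p) (idx p₀) _ hw _ hT]

theorem contMDiff_fsInner (c : ℝ) :
    ContMDiff 𝓘(ℝ, EuclideanSpace ℂ (Fin m)) (𝓘(ℝ, EuclideanSpace ℂ (Fin m)).prod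
      𝓘(ℝ, EuclideanSpace ℂ (Fin m) →L[ℝ] EuclideanSpace ℂ (Fin m) →L[ℝ] ℝ)) ∞
      (fun p : CP m => Bundle.TotalSpace.mk'
        (EuclideanSpace ℂ (Fin m) →L[ℝ] EuclideanSpace ℂ (Fin m) →L[ℝ] ℝ)
        (E := fun p : CP m => TangentSpace 𝓘(ℝ, EuclideanSpace ℂ (Fin m)) p →L[ℝ]
          TangentSpace 𝓘(ℝ, EuclideanSpace ℂ (Fin m)) p →L[ℝ] ℝ) p (fsInner c p)) := by
  intro p₀
  refine (contMDiffAt_hom_bundle _).2 ⟨contMDiffAt_id, ?_⟩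
  have h1 : ContMDiffAt 𝓘(ℝ, EuclideanSpace ℂ (Fin m))
      𝓘(ℝ, EuclideanSpace ℂ (Fin m) →L[ℝ] EuclideanSpace ℂ (Fin m) →L[ℝ] ℝ) ∞
      (fun p : CP m => scaledPullback (4 / c) (incl (idx p₀))
        (fsForm (aff (idx p₀) (affineChart (idx p₀) p)))) p₀ := by
    have h2 : ContMDiffAt 𝓘(ℝ, EuclideanSpace ℂ (Fin m)) 𝓘(ℝ, EuclideanSpace ℂ (Fin m)) ∞
      (affineChart (idx p₀)) p₀ := contMDiffAt_extChartAt
    exact (contDiffAt_scaledPullback (4 / c) (incl (idx p₀)) _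
      (contDiff_aff (idx p₀)).contDiffAt (aff_ne_zero _ _)).contMDiffAt.comp p₀ h2
  refine h1.congr_of_eventuallyEq ?_
  filter_upwards [(affineChart (idx p₀)).open_source.mem_nhds (mem_idx_source p₀)] with p hp
  have hb : p ∈ (trivializationAt (EuclideanSpace ℂ (Fin m))
      (TangentSpace 𝓘(ℝ, EuclideanSpace ℂ (Fin m))) p₀).baseSet := hp
  have hs (u : EuclideanSpace ℂ (Fin m)) : (trivializationAt (EuclideanSpace ℂ (Fin m))
      (TangentSpace 𝓘(ℝ, EuclideanSpace ℂ (Fin m))) p₀).symm p u =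
      tangentCoordChange 𝓘(ℝ, EuclideanSpace ℂ (Fin m)) p₀ p p u := by
    have h := TangentBundle.symmL_trivializationAt_eq_core
      (I := 𝓘(ℝ, EuclideanSpace ℂ (Fin m))) (b₀ := p₀) (b := p) hp
    refine Eq.trans ?_
      (congrArg (fun L : EuclideanSpace ℂ (Fin m) →L[ℝ] EuclideanSpace ℂ (Fin m) => L u) h)
    exact (Bundle.Trivialization.symmL_apply (R := ℝ) _ hb u).symm
  refine ContinuousLinearMap.ext fun u => ContinuousLinearMap.ext fun v => ?_
  refine (inCoordinates_apply_eq₂ (E₃ := Bundle.Trivial (CP m) ℝ) hb hb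
    (Set.mem_univ _)).trans ?_
  rw [hs, hs, scaledPullback_apply, ← fsInner_tangentCoordChange c p₀ p hp]
  simp

/-- The Fubini–Study metric of `CP m` with constant holomorphic sectional curvature `c`. -/
def fubiniStudyMetric (m : ℕ) (c : ℝ) (hc : 0 < c) :
    Bundle.ContMDiffRiemannianMetric 𝓘(ℝ, EuclideanSpace ℂ (Fin m)) ∞ (EuclideanSpace ℂ (Fin m))
      (fun p : CP m => TangentSpace 𝓘(ℝ, EuclideanSpace ℂ (Fin m)) p) where
  inner p := fsInner c p
  symm p u v := congrArg (4 / c * ·) (fsForm_symm _ _ _)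
  pos p u hu := mul_pos (by positivity) (fsForm_incl_pos _ _ _ hu)
  isVonNBounded p := isVonNBounded_of_pos (W := EuclideanSpace ℂ (Fin m)) _
    fun u hu => mul_pos (by positivity) (fsForm_incl_pos _ _ _ hu)
  contMDiff := contMDiff_fsInner c

end CP

section Coordinates

variable {E H M : Type*} [NormedAddCommGroup E] [NormedSpace ℝ E] [TopologicalSpace H]
  {I : ModelWithCorners ℝ E H} [TopologicalSpace M] [ChartedSpace H M] [IsManifold I ∞ M] {n : ℕ}

/-- A system of smooth local coordinates `x = (x₁, …, xₙ)` on the open set `x.source` of `M`: a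
diffeomorphism of `x.source` onto an open subset of `ℝⁿ`. -/
structure IsCoordinateSystem (I : ModelWithCorners ℝ E H)
    (x : OpenPartialHomeomorph M (EuclideanSpace ℝ (Fin n))) : Prop where
  contMDiffOn : ContMDiffOn I 𝓘(ℝ, EuclideanSpace ℝ (Fin n)) ∞ x x.source
  contMDiffOn_symm : ContMDiffOn 𝓘(ℝ, EuclideanSpace ℝ (Fin n)) I ∞ x.symm x.target

/-- The coordinate vector field `∂/∂xᵢ` at the point with coordinates `y`. -/
def coordVector (I : ModelWithCorners ℝ E H)
    (x : OpenPartialHomeomorph M (EuclideanSpace ℝ (Fin n)))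
    (y : EuclideanSpace ℝ (Fin n)) (i : Fin n) : TangentSpace I (x.symm y) :=
  mfderiv 𝓘(ℝ, EuclideanSpace ℝ (Fin n)) I x.symm y (EuclideanSpace.single i (1 : ℝ))

/-- Orthogonal coordinates for the Riemannian metric `g`: a coordinate system with
`g(∂/∂xᵢ, ∂/∂xⱼ) = 0` for `i ≠ j` everywhere on its domain. -/
structure IsOrthogonalCoordinateSystem
    (g : Bundle.ContMDiffRiemannianMetric I ∞ E (fun p : M => TangentSpace I p))
    (x : OpenPartialHomeomorph M (EuclideanSpace ℝ (Fin n))) : Prop extends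
    IsCoordinateSystem I x where
  orthogonal : ∀ y ∈ x.target, ∀ i j : Fin n, i ≠ j →
    g.inner (x.symm y) (coordVector I x y i) (coordVector I x y j) = 0

end Coordinates

end

noncomputable section

section DirectionalDerivative

variable {X V : Type*} [NormedAddCommGroup X] [NormedSpace ℝ X]
  [NormedAddCommGroup V] [InnerProductSpace ℝ V] {U : Set X}

theorem ContDiffOn.fderiv_apply_const {W : Type*} [NormedAddCommGroup W] [NormedSpace ℝ W]
    {f : X → W} (hf : ContDiffOn ℝ ∞ f U) (hU : IsOpen U) (v : X) :
    ContDiffOn ℝ ∞ (fun y => fderiv ℝ f y v) U :=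
  (hf.fderiv_of_isOpen hU (m := ∞) le_rfl).clm_apply contDiffOn_const

theorem ContDiffOn.differentiableAt_of_isOpen {W : Type*} [NormedAddCommGroup W]
    [NormedSpace ℝ W] {f : X → W} (hf : ContDiffOn ℝ ∞ f U) (hU : IsOpen U) {y : X} (hy : y ∈ U) :
    DifferentiableAt ℝ f y :=
  (hf.contDiffAt (hU.mem_nhds hy)).differentiableAt (by simp)

theorem Set.EqOn.fderiv_eq_of_isOpen {W : Type*} [NormedAddCommGroup W] [NormedSpace ℝ W]
    {f g : X → W} (h : Set.EqOn f g U) (hU : IsOpen U) {y : X} (hy : y ∈ U) :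
    fderiv ℝ f y = fderiv ℝ g y :=
  Filter.EventuallyEq.fderiv_eq (h.eventuallyEq_of_mem (hU.mem_nhds hy))

/-- Second directional derivatives of a smooth function commute. -/
theorem ContDiffOn.fderiv_fderiv_comm {W : Type*} [NormedAddCommGroup W] [NormedSpace ℝ W]
    {f : X → W} (hf : ContDiffOn ℝ ∞ f U) (hU : IsOpen U) {y : X} (hy : y ∈ U) (u v : X) :
    fderiv ℝ (fun x => fderiv ℝ f x v) y u = fderiv ℝ (fun x => fderiv ℝ f x u) y v := by
  have hd : DifferentiableAt ℝ (fderiv ℝ f) y :=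
    (hf.fderiv_of_isOpen hU (m := ∞) le_rfl).differentiableAt_of_isOpen hU hy
  have hs : IsSymmSndFDerivAt ℝ f y :=
    (hf.contDiffAt (hU.mem_nhds hy)).isSymmSndFDerivAt
      (by simpa using WithTop.coe_le_coe.2 (le_top : (2 : ℕ∞) ≤ ⊤))
  have h (a b : X) : fderiv ℝ (fun x => fderiv ℝ f x a) y b = fderiv ℝ (fderiv ℝ f) y b a := by
    rw [fderiv_clm_apply hd (differentiableAt_const a)]
    simp
  rw [h, h, hs.eq]

/-- Derivative of an inner product that is constant on an open set. -/
theorem inner_fderiv_add_eq_zero {G H : X → V} (hG : ContDiffOn ℝ ∞ G U)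
    (hH : ContDiffOn ℝ ∞ H U) (hU : IsOpen U) {a : ℝ} (h : ∀ y ∈ U, inner ℝ (G y) (H y) = a)
    {y : X} (hy : y ∈ U) (v : X) :
    inner ℝ (fderiv ℝ G y v) (H y) + inner ℝ (G y) (fderiv ℝ H y v) = 0 := by
  have h1 := fderiv_inner_apply ℝ (hG.differentiableAt_of_isOpen hU hy)
    (hH.differentiableAt_of_isOpen hU hy) v
  have h2 : fderiv ℝ (fun t => inner ℝ (G t) (H t)) y = fderiv ℝ (fun _ => a) y :=
    Set.EqOn.fderiv_eq_of_isOpen (U := U) (fun t ht => h t ht) hU hy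
  rw [h2] at h1
  simp at h1
  linarith

end DirectionalDerivative

section Skew

/-- A skew `4 × 4` matrix `ω` with `ω ωᵀ = 1` and `2 ω₁₄ ω₂₃ = ω₁₂ ω₃₄ + ω₁₃ ω₄₂` and its
permutations has all off-diagonal entries of square `1 / 3`. -/
theorem sq_eq_third_of_skew (w : Fin 4 → Fin 4 → ℝ) (hskew : ∀ i j, w i j = - w j i)
    (horth : ∀ i, ∑ l, w i l * w i l = 1)
    (hcyc : ∀ i j k l, i ≠ j → i ≠ k → i ≠ l → j ≠ k → j ≠ l → k ≠ l →
      w i k * w j l - w i j * w k l + 2 * (w j k * w i l) = 0) :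
    ∀ i j, i ≠ j → w i j ^ 2 = 1 / 3 := by
  have hz (i : Fin 4) : w i i = 0 := by linarith [hskew i i]
  have o0 := horth 0
  have o1 := horth 1
  have o2 := horth 2
  have o3 := horth 3
  simp only [Fin.sum_univ_four, hz] at o0 o1 o2 o3
  rw [hskew 1 0] at o1
  rw [hskew 2 0, hskew 2 1] at o2
  rw [hskew 3 0, hskew 3 1, hskew 3 2] at o3
  have c1 := hcyc 0 1 2 3 (by decide) (by decide) (by decide) (by decide) (by decide) (by decide)
  have c2 := hcyc 0 1 3 2 (by decide) (by decide) (by decide) (by decide) (by decide) (by decide)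
  rw [hskew 3 2] at c2
  have q1 : w 0 1 ^ 2 = w 2 3 ^ 2 := by linear_combination (o0 + o1 - o2 - o3) / 2
  have q2 : w 0 2 ^ 2 = w 1 3 ^ 2 := by linear_combination (o0 + o2 - o1 - o3) / 2
  have q3 : w 0 3 ^ 2 = w 1 2 ^ 2 := by linear_combination (o0 + o3 - o1 - o2) / 2
  have ab : w 0 1 * w 2 3 = w 0 3 * w 1 2 := by linear_combination (c2 - 2 * c1) / 3
  have bc : w 0 2 * w 1 3 = - (w 0 3 * w 1 2) := by linear_combination (c1 + c2) / 3
  have r1 : w 0 1 ^ 2 = w 0 3 ^ 2 := by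
    have : (w 0 1 ^ 2) ^ 2 = (w 0 3 ^ 2) ^ 2 := by
      linear_combination w 0 1 ^ 2 * q1 - w 0 3 ^ 2 * q3 + (w 0 1 * w 2 3 + w 0 3 * w 1 2) * ab
    exact (sq_eq_sq₀ (by positivity) (by positivity)).1 this
  have r2 : w 0 2 ^ 2 = w 0 3 ^ 2 := by
    have : (w 0 2 ^ 2) ^ 2 = (w 0 3 ^ 2) ^ 2 := by
      linear_combination w 0 2 ^ 2 * q2 - w 0 3 ^ 2 * q3 + (w 0 2 * w 1 3 - w 0 3 * w 1 2) * bc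
    exact (sq_eq_sq₀ (by positivity) (by positivity)).1 this
  have t3 : w 0 3 ^ 2 = 1 / 3 := by linear_combination o0 / 3 - r1 / 3 - r2 / 3
  have t1 := r1.trans t3
  have t2 := r2.trans t3
  have t4 := q1.symm.trans t1
  have t5 := q2.symm.trans t2
  have t6 := q3.symm.trans t3
  intro i j hij
  fin_cases i <;> fin_cases j <;>
    first
    | exact absurd rfl hij
    | assumption
    | (rw [hskew, neg_sq]; assumption)

end Skew

/-- A smooth map `F` from an open set to the unit sphere of a `6`-dimensional real inner product
space with a compatible complex structure `J`, whose derivatives along four directions `e j` are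
pairwise orthogonal and nonzero modulo `F` and `J F`. The lengths are `f j`, the unit vectors
`E j`. -/
structure HorizontalFrame {X V : Type*} [NormedAddCommGroup X] [NormedSpace ℝ X]
    [NormedAddCommGroup V] [InnerProductSpace ℝ V] (U : Set X) (e : Fin 4 → X) (J : V →L[ℝ] V)
    (F : X → V) (A f : Fin 4 → X → ℝ) (E : Fin 4 → X → V) : Prop where
  isOpen : IsOpen U
  finrank_eq : Module.finrank ℝ V = 6
  J_J : ∀ a, J (J a) = - a
  J_skew : ∀ a b, inner ℝ (J a) b = - inner ℝ a (J b)
  smooth_F : ContDiffOn ℝ ∞ F U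
  smooth_A : ∀ j, ContDiffOn ℝ ∞ (A j) U
  smooth_f : ∀ j, ContDiffOn ℝ ∞ (f j) U
  smooth_E : ∀ j, ContDiffOn ℝ ∞ (E j) U
  f_pos : ∀ y ∈ U, ∀ j, 0 < f j y
  inner_F_F : ∀ y ∈ U, inner ℝ (F y) (F y) = 1
  inner_E_F : ∀ y ∈ U, ∀ j, inner ℝ (E j y) (F y) = 0
  inner_E_JF : ∀ y ∈ U, ∀ j, inner ℝ (E j y) (J (F y)) = 0
  inner_E_E : ∀ y ∈ U, ∀ j k, inner ℝ (E j y) (E k y) = if j = k then 1 else 0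
  fderiv_F : ∀ y ∈ U, ∀ j, fderiv ℝ F y (e j) = A j y • J (F y) + f j y • E j y

namespace HorizontalFrame

variable {X V : Type*} [NormedAddCommGroup X] [NormedSpace ℝ X]
  [NormedAddCommGroup V] [InnerProductSpace ℝ V] {U : Set X} {e : Fin 4 → X} {J : V →L[ℝ] V}
  {F : X → V} {A f : Fin 4 → X → ℝ} {E : Fin 4 → X → V}

/-- The Kähler form in the frame `E`. -/
def kahler (J : V →L[ℝ] V) (E : Fin 4 → X → V) (i j : Fin 4) (y : X) : ℝ :=
  inner ℝ (J (E i y)) (E j y)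

/-- The rotation coefficient `∂ₖ fⱼ / fₖ`. -/
def rot (e : Fin 4 → X) (f : Fin 4 → X → ℝ) (k j : Fin 4) (y : X) : ℝ :=
  fderiv ℝ (f j) y (e k) / f k y

theorem inner_J_J (h : HorizontalFrame U e J F A f E)
    (a b : V) : inner ℝ (J a) (J b) = inner ℝ a b := by
  rw [h.J_skew, h.J_J, inner_neg_right, neg_neg]

theorem inner_J_self (h : HorizontalFrame U e J F A f E) (a : V) : inner ℝ (J a) a = 0 := by
  have := h.J_skew a a
  rw [real_inner_comm] at this ⊢
  linarith

theorem inner_JF_E (h : HorizontalFrame U e J F A f E)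
    {y : X} (hy : y ∈ U) (j : Fin 4) : inner ℝ (J (F y)) (E j y) = 0 := by
  rw [real_inner_comm]; exact h.inner_E_JF y hy j

theorem inner_F_E (h : HorizontalFrame U e J F A f E)
    {y : X} (hy : y ∈ U) (j : Fin 4) : inner ℝ (F y) (E j y) = 0 := by
  rw [real_inner_comm]; exact h.inner_E_F y hy j

theorem kahler_skew (h : HorizontalFrame U e J F A f E)
    (i j : Fin 4) (y : X) : kahler J E i j y = - kahler J E j i y := by
  rw [kahler, kahler, h.J_skew, real_inner_comm]

theorem smooth_JE (h : HorizontalFrame U e J F A f E)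
    (i : Fin 4) : ContDiffOn ℝ ∞ (fun y => J (E i y)) U :=
  J.contDiff.comp_contDiffOn (h.smooth_E i)

theorem smooth_JF (h : HorizontalFrame U e J F A f E) : ContDiffOn ℝ ∞ (fun y => J (F y)) U :=
  J.contDiff.comp_contDiffOn h.smooth_F

theorem smooth_kahler (h : HorizontalFrame U e J F A f E)
    (i j : Fin 4) : ContDiffOn ℝ ∞ (kahler J E i j) U :=
  (h.smooth_JE i).inner ℝ (h.smooth_E j)

theorem smooth_rot (h : HorizontalFrame U e J F A f E)
    (k j : Fin 4) : ContDiffOn ℝ ∞ (rot e f k j) U :=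
  ((h.smooth_f j).fderiv_apply_const h.isOpen (e k)).div (h.smooth_f k)
    fun y hy => (h.f_pos y hy k).ne'

theorem fderiv_J (h : HorizontalFrame U e J F A f E)
    {G : X → V} (hG : ContDiffOn ℝ ∞ G U) {y : X} (hy : y ∈ U) (v : X) :
    fderiv ℝ (fun x => J (G x)) y v = J (fderiv ℝ G y v) := by
  have := (J.hasFDerivAt.comp y (hG.differentiableAt_of_isOpen h.isOpen hy).hasFDerivAt).fderiv
  exact congrArg (fun L => L v) this

/-- At each point the vectors `F`, `J F` and `E j` span the space. -/
theorem eq_zero_of_inner (h : HorizontalFrame U e J F A f E)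
    {y : X} (hy : y ∈ U) {a : V} (h0 : inner ℝ a (F y) = 0)
    (h1 : inner ℝ a (J (F y)) = 0) (h2 : ∀ j, inner ℝ a (E j y) = 0) : a = 0 := by
  have : FiniteDimensional ℝ V := Module.finite_of_finrank_pos (by rw [h.finrank_eq]; norm_num)
  let b : Option (Option (Fin 4)) → V
    | none => F y
    | some none => J (F y)
    | some (some j) => E j y
  have hb : Orthonormal ℝ b := by
    rw [orthonormal_iff_ite]
    rintro (_ | _ | i) (_ | _ | j)
    · simpa [b] using h.inner_F_F y hy
    · simpa [b, real_inner_comm] using h.inner_J_self (F y)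
    · simpa [b] using h.inner_F_E hy j
    · simp [b, h.inner_J_self]
    · simpa only [b, h.inner_J_J, if_true] using h.inner_F_F y hy
    · simpa [b] using h.inner_JF_E hy j
    · simpa [b] using h.inner_E_F y hy i
    · simpa [b] using h.inner_E_JF y hy i
    · simp [b, h.inner_E_E y hy i j]
  let B := basisOfOrthonormalOfCardEqFinrank hb (by simp [h.finrank_eq])
  refine InnerProductSpace.ext_inner_right_basis B fun i => ?_
  rw [coe_basisOfOrthonormalOfCardEqFinrank, inner_zero_left]
  rcases i with _ | _ | j
  · exact h0
  · exact h1
  · exact h2 j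

theorem J_E (h : HorizontalFrame U e J F A f E) {y : X} (hy : y ∈ U) (i : Fin 4) :
    J (E i y) = ∑ l, kahler J E i l y • E l y := by
  rw [← sub_eq_zero]
  refine h.eq_zero_of_inner hy ?_ ?_ fun j => ?_
  · simp [inner_sub_left, sum_inner, inner_smul_left, h.inner_E_F y hy, h.J_skew,
      h.inner_E_JF y hy]
  · simp [inner_sub_left, sum_inner, inner_smul_left, h.inner_E_JF y hy, h.inner_J_J,
      h.inner_E_F y hy]
  · simp [inner_sub_left, sum_inner, inner_smul_left, h.inner_E_E y hy, kahler]

theorem sum_kahler_mul (h : HorizontalFrame U e J F A f E) {y : X} (hy : y ∈ U) (i k : Fin 4) :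
    ∑ l, kahler J E i l y * kahler J E k l y = if i = k then 1 else 0 := by
  rw [← h.inner_E_E y hy i k, ← h.inner_J_J, h.J_E hy i, sum_inner]
  refine Finset.sum_congr rfl fun l _ => ?_
  rw [inner_smul_left, real_inner_comm, kahler, kahler]
  simp

theorem inner_fderiv_E_F (h : HorizontalFrame U e J F A f E) {y : X} (hy : y ∈ U) (j k : Fin 4) :
    inner ℝ (fderiv ℝ (E k) y (e j)) (F y) = - (f j y * if k = j then 1 else 0) := by
  have := inner_fderiv_add_eq_zero (h.smooth_E k) h.smooth_F h.isOpen
    (fun y hy => h.inner_E_F y hy k) hy (e j)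
  rw [h.fderiv_F y hy, inner_add_right, inner_smul_right, inner_smul_right, h.inner_E_JF y hy,
    h.inner_E_E y hy] at this
  linarith

theorem inner_fderiv_E_JF (h : HorizontalFrame U e J F A f E) {y : X} (hy : y ∈ U) (j k : Fin 4) :
    inner ℝ (fderiv ℝ (E k) y (e j)) (J (F y)) = - (f j y * kahler J E j k y) := by
  have := inner_fderiv_add_eq_zero (h.smooth_E k) h.smooth_JF h.isOpen
    (fun y hy => h.inner_E_JF y hy k) hy (e j)
  rw [h.fderiv_J h.smooth_F hy, h.fderiv_F y hy, map_add, map_smul, map_smul, h.J_J,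
    inner_add_right, inner_smul_right, inner_smul_right, inner_neg_right, h.inner_E_F y hy,
    real_inner_comm] at this
  rw [kahler, real_inner_comm]
  rw [real_inner_comm (J (E j y))] at this
  linarith

theorem inner_fderiv_E_E (h : HorizontalFrame U e J F A f E) {y : X} (hy : y ∈ U) (j k l : Fin 4) :
    inner ℝ (fderiv ℝ (E k) y (e j)) (E l y) = - inner ℝ (fderiv ℝ (E l) y (e j)) (E k y) := by
  have := inner_fderiv_add_eq_zero (h.smooth_E k) (h.smooth_E l) h.isOpen
    (fun y hy => h.inner_E_E y hy k l) hy (e j)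
  rw [real_inner_comm (fderiv ℝ (E l) y (e j))] at this
  linarith

theorem fderiv_fderiv_F (h : HorizontalFrame U e J F A f E) {y : X} (hy : y ∈ U) (j k : Fin 4) :
    fderiv ℝ (fun x => fderiv ℝ F x (e k)) y (e j) =
      fderiv ℝ (A k) y (e j) • J (F y) + A k y • (- A j y • F y + f j y • J (E j y)) +
      (fderiv ℝ (f k) y (e j) • E k y + f k y • fderiv ℝ (E k) y (e j)) := by
  have hA := (h.smooth_A k).differentiableAt_of_isOpen h.isOpen hy
  have hf := (h.smooth_f k).differentiableAt_of_isOpen h.isOpen hy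
  have hE := (h.smooth_E k).differentiableAt_of_isOpen h.isOpen hy
  have hJF := h.smooth_JF.differentiableAt_of_isOpen h.isOpen hy
  have h1 : fderiv ℝ (fun x => fderiv ℝ F x (e k)) y =
      fderiv ℝ (fun x => A k x • J (F x) + f k x • E k x) y :=
    Set.EqOn.fderiv_eq_of_isOpen (U := U) (fun x hx => h.fderiv_F x hx k) h.isOpen hy
  rw [h1, fderiv_fun_add (hA.fun_smul hJF) (hf.fun_smul hE), fderiv_fun_smul hA hJF,
    fderiv_fun_smul hf hE]
  simp only [add_apply, smul_apply, ContinuousLinearMap.smulRight_apply]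
  rw [h.fderiv_J h.smooth_F hy, h.fderiv_F y hy j, map_add, map_smul, map_smul, h.J_J]
  module

theorem torsion (h : HorizontalFrame U e J F A f E) {y : X} (hy : y ∈ U) (j k l : Fin 4) :
    A k y * (f j y * kahler J E j l y) + (fderiv ℝ (f k) y (e j) * (if k = l then 1 else 0) +
      f k y * inner ℝ (fderiv ℝ (E k) y (e j)) (E l y)) =
    A j y * (f k y * kahler J E k l y) + (fderiv ℝ (f j) y (e k) * (if j = l then 1 else 0) +
      f j y * inner ℝ (fderiv ℝ (E j) y (e k)) (E l y)) := by
  have := h.smooth_F.fderiv_fderiv_comm h.isOpen hy (e j) (e k)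
  rw [h.fderiv_fderiv_F hy, h.fderiv_fderiv_F hy] at this
  have := congrArg (fun a => inner ℝ a (E l y)) this
  simp only [inner_add_left, real_inner_smul_left, h.inner_JF_E hy, h.inner_F_E hy,
    h.inner_E_E y hy] at this
  simp only [kahler]
  linarith

/-- The curvature of the connection form `A` is twice the Kähler form. -/
theorem curvature_A (h : HorizontalFrame U e J F A f E) {y : X} (hy : y ∈ U) (j k : Fin 4) :
    fderiv ℝ (A k) y (e j) - fderiv ℝ (A j) y (e k) = 2 * (f j y * f k y * kahler J E j k y) := by
  have := h.smooth_F.fderiv_fderiv_comm h.isOpen hy (e j) (e k)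
  rw [h.fderiv_fderiv_F hy, h.fderiv_fderiv_F hy] at this
  have := congrArg (fun a => inner ℝ a (J (F y))) this
  simp only [inner_add_left, real_inner_smul_left, h.inner_J_J, h.inner_F_F y hy,
    h.inner_E_F y hy, h.inner_E_JF y hy, h.inner_fderiv_E_JF hy,
    real_inner_comm (J (F y)) (F y), h.inner_J_self] at this
  rw [h.kahler_skew k j] at this
  linarith

theorem inner_fderiv_E_E_of_ne (h : HorizontalFrame U e J F A f E)
    {y : X} (hy : y ∈ U) {j k : Fin 4} (hjk : j ≠ k) (l : Fin 4) :
    inner ℝ (fderiv ℝ (E k) y (e j)) (E l y) =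
      A j y * kahler J E k l y + rot e f k j y * (if j = l then 1 else 0) := by
  have hfj := (h.f_pos y hy j).ne'
  have hfk := (h.f_pos y hy k).ne'
  have hfl := (h.f_pos y hy l).ne'
  by_cases hl : j = l
  · subst hl
    have t := h.torsion hy j k j
    have a := h.inner_fderiv_E_E hy k j j
    have w0 : kahler J E j j y = 0 := h.inner_J_self _
    rw [w0, if_neg hjk.symm, if_pos rfl] at t
    have a' : inner ℝ (fderiv ℝ (E j) y (e k)) (E j y) = (0 : ℝ) := by linarith
    rw [a'] at t
    rw [if_pos rfl, rot]
    field_simp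
    linarith
  by_cases hk : k = l
  · subst hk
    have a := h.inner_fderiv_E_E hy j k k
    have w0 : kahler J E k k y = 0 := h.inner_J_self _
    rw [w0, if_neg hl]
    linarith
  have t1 := h.torsion hy j k l
  have t2 := h.torsion hy k l j
  have t3 := h.torsion hy l j k
  rw [if_neg hl, if_neg hk] at t1
  rw [if_neg hjk.symm, if_neg (Ne.symm hl)] at t2
  rw [if_neg hjk, if_neg (Ne.symm hk)] at t3
  rw [h.inner_fderiv_E_E hy k l j, h.kahler_skew l j, h.inner_fderiv_E_E hy l k j,
    h.kahler_skew k j] at t2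
  rw [h.inner_fderiv_E_E hy j l k, h.kahler_skew l k] at t3
  rw [if_neg hl]
  have : f k y * f l y * (inner ℝ (fderiv ℝ (E k) y (e j)) (E l y) - A j y * kahler J E k l y)
      = 0 := by
    linear_combination (f l y * t1 - f j y * t2 + f k y * t3) / 2
  have := (mul_eq_zero.1 this).resolve_left (mul_ne_zero hfk hfl)
  linarith

/-- The structure equation for the frame. -/
theorem fderiv_E (h : HorizontalFrame U e J F A f E)
    {y : X} (hy : y ∈ U) {j k : Fin 4} (hjk : j ≠ k) :
    fderiv ℝ (E k) y (e j) = A j y • J (E k y) + rot e f k j y • E j y -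
      (f j y * kahler J E j k y) • J (F y) := by
  rw [← sub_eq_zero]
  refine h.eq_zero_of_inner hy ?_ ?_ fun l => ?_
  · simp only [inner_add_left, inner_sub_left, real_inner_smul_left, h.inner_fderiv_E_F hy,
      h.inner_E_F y hy, h.inner_J_self, if_neg hjk.symm, h.J_skew (E k y), h.inner_E_JF y hy]
    ring
  · simp only [inner_add_left, inner_sub_left, real_inner_smul_left, h.inner_fderiv_E_JF hy,
      h.inner_E_JF y hy, h.inner_J_J, h.inner_E_F y hy, h.inner_F_F y hy]
    ring
  · simp only [inner_add_left, inner_sub_left, real_inner_smul_left,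
      h.inner_fderiv_E_E_of_ne hy hjk, h.inner_JF_E hy, h.inner_E_E y hy, kahler]
    ring

theorem inner_fderiv_fderiv_E (h : HorizontalFrame U e J F A f E)
    {y : X} (hy : y ∈ U) {i j k : Fin 4} (hij : i ≠ j) (hik : i ≠ k)
    (hjk : j ≠ k) (l : Fin 4) :
    inner ℝ (fderiv ℝ (fun x => fderiv ℝ (E i) x (e k)) y (e j)) (E l y) =
      fderiv ℝ (A k) y (e j) * kahler J E i l y +
      A k y * (- A j y * (if i = l then 1 else 0) + rot e f i j y * kahler J E j l y) +
      fderiv ℝ (rot e f i k) y (e j) * (if k = l then 1 else 0) +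
      rot e f i k y * (A j y * kahler J E k l y + rot e f k j y * (if j = l then 1 else 0)) -
      f k y * kahler J E k i y * (f j y * kahler J E j l y) := by
  have hA := (h.smooth_A k).differentiableAt_of_isOpen h.isOpen hy
  have hr := (h.smooth_rot i k).differentiableAt_of_isOpen h.isOpen hy
  have hE := (h.smooth_E k).differentiableAt_of_isOpen h.isOpen hy
  have hJE := (h.smooth_JE i).differentiableAt_of_isOpen h.isOpen hy
  have hJF := h.smooth_JF.differentiableAt_of_isOpen h.isOpen hy
  have hfw := ((h.smooth_f k).mul (h.smooth_kahler k i)).differentiableAt_of_isOpen h.isOpen hy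
  have h1 : fderiv ℝ (fun x => fderiv ℝ (E i) x (e k)) y =
      fderiv ℝ (fun x => A k x • J (E i x) + rot e f i k x • E k x -
        (f k x * kahler J E k i x) • J (F x)) y :=
    Set.EqOn.fderiv_eq_of_isOpen (U := U) (fun x hx => h.fderiv_E hx hik.symm) h.isOpen hy
  rw [h1, fderiv_fun_sub ((hA.fun_smul hJE).fun_add (hr.fun_smul hE)) (hfw.fun_smul hJF),
    fderiv_fun_add (hA.fun_smul hJE) (hr.fun_smul hE), fderiv_fun_smul hA hJE,
    fderiv_fun_smul hr hE, fderiv_fun_smul hfw hJF]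
  simp only [add_apply, sub_apply, smul_apply, ContinuousLinearMap.smulRight_apply]
  rw [h.fderiv_J h.smooth_F hy, h.fderiv_J (h.smooth_E i) hy, h.fderiv_F y hy j,
    h.fderiv_E hy hij.symm, h.fderiv_E hy hjk]
  simp only [map_add, map_sub, map_smul, h.J_J, inner_add_left, inner_sub_left, inner_neg_left,
    real_inner_smul_left, h.inner_JF_E hy, h.inner_F_E hy, h.inner_E_E y hy, kahler]
  ring

theorem kahler_cyclic (h : HorizontalFrame U e J F A f E)
    {y : X} (hy : y ∈ U) {i j k l : Fin 4} (hij : i ≠ j) (hik : i ≠ k)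
    (hil : i ≠ l) (hjk : j ≠ k) (hjl : j ≠ l) (hkl : k ≠ l) :
    kahler J E i k y * kahler J E j l y - kahler J E i j y * kahler J E k l y +
      2 * (kahler J E j k y * kahler J E i l y) = 0 := by
  have hc := congrArg (fun a => inner ℝ a (E l y))
    ((h.smooth_E i).fderiv_fderiv_comm h.isOpen hy (e j) (e k))
  simp only [h.inner_fderiv_fderiv_E hy hij hik hjk, h.inner_fderiv_fderiv_E hy hik hij hjk.symm,
    if_neg hil, if_neg hjl, if_neg hkl] at hc
  have hA := h.curvature_A hy j k
  rw [h.kahler_skew k i, h.kahler_skew j i] at hc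
  have : f j y * f k y * (kahler J E i k y * kahler J E j l y -
      kahler J E i j y * kahler J E k l y + 2 * (kahler J E j k y * kahler J E i l y)) = 0 := by
    linear_combination hc - kahler J E i l y * hA
  exact (mul_eq_zero.1 this).resolve_left
    (mul_ne_zero (h.f_pos y hy j).ne' (h.f_pos y hy k).ne')

theorem fderiv_rot (h : HorizontalFrame U e J F A f E)
    {y : X} (hy : y ∈ U) {i j k : Fin 4} (hij : i ≠ j) (hik : i ≠ k)
    (hjk : j ≠ k) :
    fderiv ℝ (rot e f i j) y (e k) = rot e f i k y * rot e f k j y +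
      3 * (f j y * f k y * kahler J E i j y * kahler J E j k y) := by
  have hc := congrArg (fun a => inner ℝ a (E j y))
    ((h.smooth_E i).fderiv_fderiv_comm h.isOpen hy (e j) (e k))
  simp only [h.inner_fderiv_fderiv_E hy hij hik hjk, h.inner_fderiv_fderiv_E hy hik hij hjk.symm,
    if_neg hij, if_neg hjk.symm, if_true] at hc
  have hA := h.curvature_A hy j k
  have w0 : kahler J E j j y = 0 := h.inner_J_self _
  rw [h.kahler_skew k j, h.kahler_skew j i, w0] at hc
  linear_combination -hc + kahler J E i j y * hA

theorem kahler_sq (h : HorizontalFrame U e J F A f E)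
    {y : X} (hy : y ∈ U) {i j : Fin 4} (hij : i ≠ j) :
    kahler J E i j y ^ 2 = 1 / 3 :=
  sq_eq_third_of_skew (fun i j => kahler J E i j y) (fun i j => h.kahler_skew i j y)
    (fun i => by simpa using h.sum_kahler_mul hy i i)
    (fun _ _ _ _ hij hik hil hjk hjl hkl => h.kahler_cyclic hy hij hik hil hjk hjl hkl) i j hij

theorem fderiv_kahler (h : HorizontalFrame U e J F A f E)
    {y : X} (hy : y ∈ U) {i j : Fin 4} (hij : i ≠ j) (v : X) :
    fderiv ℝ (kahler J E i j) y v = 0 := by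
  have hd := (h.smooth_kahler i j).differentiableAt_of_isOpen h.isOpen hy
  have h1 : fderiv ℝ (fun x => kahler J E i j x * kahler J E i j x) y =
      fderiv ℝ (fun _ => (1 / 3 : ℝ)) y :=
    Set.EqOn.fderiv_eq_of_isOpen (U := U)
      (fun x hx => by simpa only [pow_two] using h.kahler_sq hx hij) h.isOpen hy
  rw [fderiv_fun_mul hd hd] at h1
  have h2 := congrArg (fun L => L v) h1
  simp only [add_apply, smul_apply, smul_eq_mul, fderiv_fun_const, Pi.zero_apply, zero_apply] at h2
  have h3 : kahler J E i j y ≠ 0 := fun h0 => by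
    have := h.kahler_sq hy hij
    rw [h0] at this
    norm_num at this
  have : kahler J E i j y * fderiv ℝ (kahler J E i j) y v = 0 := by linarith
  exact (mul_eq_zero.1 this).resolve_left h3

theorem rot_mul_kahler (h : HorizontalFrame U e J F A f E)
    {y : X} (hy : y ∈ U) {i j k : Fin 4} (hij : i ≠ j) (hik : i ≠ k)
    (hjk : j ≠ k) : rot e f i k y * kahler J E j k y = rot e f j k y * kahler J E i k y := by
  have h1 : fderiv ℝ (kahler J E i j) y (e k) = _ :=
    fderiv_inner_apply ℝ ((h.smooth_JE i).differentiableAt_of_isOpen h.isOpen hy)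
      ((h.smooth_E j).differentiableAt_of_isOpen h.isOpen hy) (e k)
  rw [h.fderiv_kahler hy hij, h.fderiv_J (h.smooth_E i) hy, h.fderiv_E hy hik.symm,
    h.fderiv_E hy hjk.symm] at h1
  simp only [map_add, map_sub, map_smul, h.J_J, inner_add_left, inner_sub_left, inner_neg_left,
    inner_add_right, inner_sub_right, real_inner_smul_right, h.inner_J_J,
    real_inner_smul_left, h.inner_F_E hy, h.inner_E_F y hy, h.inner_E_E y hy] at h1
  have h2 : inner ℝ (J (E k y)) (E j y) = - kahler J E j k y := h.kahler_skew k j y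
  have h3 : inner ℝ (J (E i y)) (E k y) = kahler J E i k y := rfl
  rw [h2, h3] at h1
  linarith

/-- The common value `sⱼ` of the quotients `βᵢⱼ / ωⱼᵢ`, for `i ≠ j`. -/
def potential (e : Fin 4 → X) (J : V →L[ℝ] V) (f : Fin 4 → X → ℝ) (E : Fin 4 → X → V)
    (i j : Fin 4) (y : X) : ℝ :=
  3 * (rot e f i j y * kahler J E j i y)

theorem smooth_potential (h : HorizontalFrame U e J F A f E)
    (i j : Fin 4) : ContDiffOn ℝ ∞ (potential e J f E i j) U :=
  contDiffOn_const.mul ((h.smooth_rot i j).mul (h.smooth_kahler j i))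

theorem potential_eq (h : HorizontalFrame U e J F A f E)
    {y : X} (hy : y ∈ U) {i j k : Fin 4} (hij : i ≠ j) (hik : i ≠ k)
    (hjk : j ≠ k) : potential e J f E i k y = potential e J f E j k y := by
  have h1 := h.rot_mul_kahler hy hij hik hjk
  have h2 := h.kahler_sq hy hik
  have h3 := h.kahler_sq hy hjk
  rw [potential, potential, h.kahler_skew k i, h.kahler_skew k j]
  linear_combination -9 * kahler J E i k y * kahler J E j k y * h1 +
    9 * rot e f i k y * kahler J E i k y * h3 - 9 * rot e f j k y * kahler J E j k y * h2

theorem rot_eq (h : HorizontalFrame U e J F A f E)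
    {y : X} (hy : y ∈ U) {i j : Fin 4} (hij : i ≠ j) :
    rot e f i j y = potential e J f E i j y * kahler J E j i y := by
  rw [potential]
  linear_combination -3 * rot e f i j y * h.kahler_sq hy hij.symm

theorem fderiv_potential (h : HorizontalFrame U e J F A f E)
    {y : X} (hy : y ∈ U) {i j k : Fin 4} (hij : i ≠ j) (hik : i ≠ k)
    (hjk : j ≠ k) :
    fderiv ℝ (potential e J f E i j) y (e k) =
      3 * (potential e J f E i k y * potential e J f E i j y * kahler J E j i y *
        kahler J E k i y * kahler J E j k y) - 3 * (f j y * f k y * kahler J E j k y) := by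
  have hr := (h.smooth_rot i j).differentiableAt_of_isOpen h.isOpen hy
  have hw := (h.smooth_kahler j i).differentiableAt_of_isOpen h.isOpen hy
  have h1 : fderiv ℝ (potential e J f E i j) y =
      fderiv ℝ (fun x => 3 * (rot e f i j x * kahler J E j i x)) y := rfl
  rw [h1, fderiv_const_mul (hr.fun_mul hw), fderiv_fun_mul hr hw]
  simp only [add_apply, smul_apply, smul_eq_mul]
  rw [h.fderiv_kahler hy hij.symm, h.fderiv_rot hy hij hik hjk, h.rot_eq hy hik,
    h.rot_eq hy hjk.symm, ← h.potential_eq hy hik hij hjk.symm, h.kahler_skew i j]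
  linear_combination -9 * f j y * f k y * kahler J E j k y * h.kahler_sq hy hij.symm

/-- The products `sⱼ sₖ` vanish, but the derivatives `∂ₖ sⱼ` do not. -/
theorem potential_mul_and_fderiv (h : HorizontalFrame U e J F A f E)
    {y : X} (hy : y ∈ U) {i l j k : Fin 4} (hil : i ≠ l)
    (hij : i ≠ j) (hik : i ≠ k) (hlj : l ≠ j) (hlk : l ≠ k) (hjk : j ≠ k)
    (hsum : kahler J E j i y * kahler J E k i y + kahler J E j l y * kahler J E k l y = 0) :
    potential e J f E i k y * potential e J f E i j y = 0 ∧
      fderiv ℝ (potential e J f E i j) y (e k) ≠ 0 := by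
  have d1 := h.fderiv_potential hy hij hik hjk
  have d2 := h.fderiv_potential hy hlj hlk hjk
  have h1 : fderiv ℝ (potential e J f E l j) y = fderiv ℝ (potential e J f E i j) y :=
    Set.EqOn.fderiv_eq_of_isOpen (U := U) (fun x hx => h.potential_eq hx hil.symm hlj hij)
      h.isOpen hy
  rw [h1, h.potential_eq hy hil.symm hlj hij, h.potential_eq hy hil.symm hlk hik] at d2
  have hne {a b : Fin 4} (hab : a ≠ b) : kahler J E a b y ≠ 0 := fun h0 => by
    have := h.kahler_sq hy hab
    rw [h0] at this
    norm_num at this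
  constructor
  · have : potential e J f E i k y * potential e J f E i j y *
        (6 * (kahler J E j i y * kahler J E k i y * kahler J E j k y)) = 0 := by
      linear_combination d2 - d1 + 3 * potential e J f E i k y * potential e J f E i j y *
        kahler J E j k y * hsum
    refine (mul_eq_zero.1 this).resolve_right ?_
    have := hne hij.symm
    have := hne hik.symm
    have := hne hjk
    positivity
  · have : fderiv ℝ (potential e J f E i j) y (e k) = -3 * (f j y * f k y * kahler J E j k y) := by
      linear_combination (d1 + d2) / 2 + 3 / 2 * potential e J f E i k y *
        potential e J f E i j y * kahler J E j k y * hsum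
    rw [this]
    have := hne hjk
    have := h.f_pos y hy j
    have := h.f_pos y hy k
    simp only [ne_eq, mul_eq_zero, not_or]
    refine ⟨by norm_num, ⟨by positivity, by positivity⟩, by assumption⟩

/-- Such frames do not exist on a nonempty open set. -/
theorem not_nonempty (h : HorizontalFrame U e J F A f E) : ¬ U.Nonempty := by
  rintro ⟨y₀, hy₀⟩
  have hsum {y : X} (hy : y ∈ U) : kahler J E 0 2 y * kahler J E 1 2 y +
      kahler J E 0 3 y * kahler J E 1 3 y = 0 := by
    have h1 := h.sum_kahler_mul hy 0 1
    have w0 : kahler J E 0 0 y = 0 := h.inner_J_self _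
    have w1 : kahler J E 1 1 y = 0 := h.inner_J_self _
    rw [Fin.sum_univ_four, w0, w1, if_neg (by decide)] at h1
    linarith
  set s := potential e J f E 2 0
  set t := potential e J f E 2 1
  have hst {y : X} (hy : y ∈ U) : t y * s y = 0 ∧ fderiv ℝ s y (e 1) ≠ 0 :=
    h.potential_mul_and_fderiv (i := 2) (l := 3) (j := 0) (k := 1) hy (by decide) (by decide)
      (by decide) (by decide) (by decide) (by decide) (hsum hy)
  have hts {y : X} (hy : y ∈ U) : fderiv ℝ t y (e 0) ≠ 0 :=
    (h.potential_mul_and_fderiv (i := 2) (l := 3) (j := 1) (k := 0) hy (by decide) (by decide)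
      (by decide) (by decide) (by decide) (by decide) (by linarith [hsum hy])).2
  have hsd {y : X} (hy : y ∈ U) : DifferentiableAt ℝ s y :=
    (h.smooth_potential 2 0).differentiableAt_of_isOpen h.isOpen hy
  have htd {y : X} (hy : y ∈ U) : DifferentiableAt ℝ t y :=
    (h.smooth_potential 2 1).differentiableAt_of_isOpen h.isOpen hy
  have hs0 {y : X} (hy : y ∈ U) : s y = 0 := by
    have h1 : fderiv ℝ (fun x => t x * s x) y = fderiv ℝ (fun _ => (0 : ℝ)) y :=
      Set.EqOn.fderiv_eq_of_isOpen (U := U) (fun x hx => (hst hx).1) h.isOpen hy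
    rw [fderiv_fun_mul (htd hy) (hsd hy)] at h1
    have h2 := congrArg (fun L => L (e 0)) h1
    simp only [add_apply, smul_apply, smul_eq_mul, fderiv_fun_const, Pi.zero_apply,
      zero_apply] at h2
    rcases mul_eq_zero.1 (hst hy).1 with h3 | h3
    · rw [h3, zero_mul, zero_add] at h2
      exact (mul_eq_zero.1 h2).resolve_right (hts hy)
    · exact h3
  have h4 : fderiv ℝ s y₀ = fderiv ℝ (fun _ => (0 : ℝ)) y₀ :=
    Set.EqOn.fderiv_eq_of_isOpen (U := U) (fun x hx => hs0 hx) h.isOpen hy₀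
  apply (hst hy₀).2
  rw [h4]
  simp

end HorizontalFrame

namespace CP

/-- Multiplication by the imaginary unit. -/
def mulI (m : ℕ) : EuclideanSpace ℂ (Fin (m + 1)) →L[ℝ] EuclideanSpace ℂ (Fin (m + 1)) :=
  Complex.I • ContinuousLinearMap.id ℝ (EuclideanSpace ℂ (Fin (m + 1)))

variable {m : ℕ}

theorem mulI_mulI (a : EuclideanSpace ℂ (Fin (m + 1))) : mulI m (mulI m a) = - a := by
  simp [mulI, smul_smul]

theorem inner_mulI (a b : EuclideanSpace ℂ (Fin (m + 1))) :
    inner ℝ (mulI m a) b = - inner ℝ a (mulI m b) := by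
  rw [real_inner_eq, real_inner_eq]
  simp [mulI]

theorem fsForm_apply_of_norm_eq_one {z : EuclideanSpace ℂ (Fin (m + 1))} (hz : ‖z‖ = 1)
    (a b : EuclideanSpace ℂ (Fin (m + 1))) :
    fsForm z a b = inner ℝ a b - (inner ℝ z a * inner ℝ z b +
      inner ℝ (mulI m z) a * inner ℝ (mulI m z) b) := by
  rw [fsForm, horizontalForm_apply, hz, mulI]
  simp

end CP

/-- A nowhere vanishing map to `ℂ³` cannot have four directional derivatives that are pairwise
orthogonal for the Fubini–Study form and of positive length. -/
theorem CP.not_nonempty_of_fsForm_orthogonal {X : Type*} [NormedAddCommGroup X] [NormedSpace ℝ X]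
    {U : Set X} (hU : IsOpen U) (e : Fin 4 → X) {z : X → EuclideanSpace ℂ (Fin (2 + 1))}
    (hz : ContDiffOn ℝ ∞ z U) (hz0 : ∀ y ∈ U, z y ≠ 0)
    (hpos : ∀ y ∈ U, ∀ i, 0 < CP.fsForm (z y) (fderiv ℝ z y (e i)) (fderiv ℝ z y (e i)))
    (horth : ∀ y ∈ U, ∀ i j, i ≠ j →
      CP.fsForm (z y) (fderiv ℝ z y (e i)) (fderiv ℝ z y (e j)) = 0) : ¬ U.Nonempty := by
  set J := CP.mulI 2
  set r : X → ℝ := fun y => ‖z y‖⁻¹ with hr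
  set F : X → EuclideanSpace ℂ (Fin (2 + 1)) := fun y => r y • z y with hFdef
  have hr0 (y) (hy : y ∈ U) : r y ≠ 0 := inv_ne_zero (norm_ne_zero_iff.2 (hz0 y hy))
  have hrs : ContDiffOn ℝ ∞ r U :=
    (hz.norm ℝ hz0).inv fun y hy => norm_ne_zero_iff.2 (hz0 y hy)
  have hFs : ContDiffOn ℝ ∞ F U := hrs.smul hz
  have hFn (y) (hy : y ∈ U) : ‖F y‖ = 1 := by
    simp [hFdef, hr, norm_smul, inv_mul_cancel₀ (norm_ne_zero_iff.2 (hz0 y hy))]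
  have hFF (y) (hy : y ∈ U) : inner ℝ (F y) (F y) = (1 : ℝ) := by
    rw [real_inner_self_eq_norm_sq, hFn y hy, one_pow]
  have hform (y) (hy : y ∈ U) (i j : Fin 4) :
      CP.fsForm (F y) (fderiv ℝ F y (e i)) (fderiv ℝ F y (e j)) =
        CP.fsForm (z y) (fderiv ℝ z y (e i)) (fderiv ℝ z y (e j)) := by
    have hd (i : Fin 4) : fderiv ℝ F y (e i) = ((r y : ℝ) : ℂ) • fderiv ℝ z y (e i) +
        ((fderiv ℝ r y (e i) : ℝ) : ℂ) • z y := by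
      rw [hFdef, fderiv_fun_smul (hrs.differentiableAt_of_isOpen hU hy)
        (hz.differentiableAt_of_isOpen hU hy)]
      simp
    have hFy : F y = ((r y : ℝ) : ℂ) • z y := by simp [hFdef]
    rw [hd, hd, hFy, CP.fsForm_smul_add (hz0 y hy) (by exact_mod_cast hr0 y hy)]
  have hperp (y) (hy : y ∈ U) (i : Fin 4) : inner ℝ (F y) (fderiv ℝ F y (e i)) = (0 : ℝ) := by
    have := inner_fderiv_add_eq_zero hFs hFs hU hFF hy (e i)
    rw [real_inner_comm] at this
    linarith
  set A : Fin 4 → X → ℝ := fun j y => inner ℝ (J (F y)) (fderiv ℝ F y (e j)) with hA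
  have hJF : ContDiffOn ℝ ∞ (fun y => J (F y)) U := J.contDiff.comp_contDiffOn hFs
  have hdF (j : Fin 4) := hFs.fderiv_apply_const hU (e j)
  have hAs (j : Fin 4) : ContDiffOn ℝ ∞ (A j) U := hJF.inner ℝ (hdF j)
  set D : Fin 4 → X → EuclideanSpace ℂ (Fin (2 + 1)) :=
    fun j y => fderiv ℝ F y (e j) - A j y • J (F y) with hD
  have hDs (j : Fin 4) : ContDiffOn ℝ ∞ (D j) U := (hdF j).sub ((hAs j).smul hJF)
  have hJFF (y) : inner ℝ (J (F y)) (F y) = (0 : ℝ) := by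
    have := CP.inner_mulI (F y) (F y)
    rw [real_inner_comm] at this ⊢
    linarith
  have hJJ (y) (hy : y ∈ U) : inner ℝ (J (F y)) (J (F y)) = (1 : ℝ) := by
    rw [CP.inner_mulI, CP.mulI_mulI, inner_neg_right, hFF y hy, neg_neg]
  have hDD (y) (hy : y ∈ U) (i j : Fin 4) : inner ℝ (D i y) (D j y) =
      CP.fsForm (z y) (fderiv ℝ z y (e i)) (fderiv ℝ z y (e j)) := by
    rw [← hform y hy, CP.fsForm_apply_of_norm_eq_one (hFn y hy), hperp y hy, hperp y hy]
    simp only [hD, inner_sub_left, inner_sub_right, real_inner_smul_left, real_inner_smul_right,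
      hJJ y hy, real_inner_comm (J (F y)) (fderiv ℝ F y (e i)), hA]
    ring
  set f : Fin 4 → X → ℝ := fun j y => ‖D j y‖
  have hD0 (y) (hy : y ∈ U) (j : Fin 4) : D j y ≠ 0 := fun h0 => by
    have := hpos y hy j
    rw [← hDD y hy, h0] at this
    simp at this
  have hfs (j : Fin 4) : ContDiffOn ℝ ∞ (f j) U := (hDs j).norm ℝ fun y hy => hD0 y hy j
  have hf0 (y) (hy : y ∈ U) (j : Fin 4) : 0 < f j y := norm_pos_iff.2 (hD0 y hy j)
  have hDF (y) (hy : y ∈ U) (j : Fin 4) : inner ℝ (D j y) (F y) = (0 : ℝ) := by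
    simp only [hD, inner_sub_left, real_inner_smul_left, hJFF,
      real_inner_comm (F y) (fderiv ℝ F y (e j)), hperp y hy]
    ring
  have hDJF (y) (hy : y ∈ U) (j : Fin 4) : inner ℝ (D j y) (J (F y)) = (0 : ℝ) := by
    simp only [hD, inner_sub_left, real_inner_smul_left, hJJ y hy, hA]
    rw [real_inner_comm (J (F y))]
    ring
  have frame : HorizontalFrame U e J F A f (fun j y => (f j y)⁻¹ • D j y) :=
    { isOpen := hU
      finrank_eq := by
        rw [finrank_real_of_complex, finrank_euclideanSpace_fin]
      J_J := CP.mulI_mulI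
      J_skew := CP.inner_mulI
      smooth_F := hFs
      smooth_A := hAs
      smooth_f := hfs
      smooth_E := fun j => ((hfs j).inv fun y hy => (hf0 y hy j).ne').smul (hDs j)
      f_pos := hf0
      inner_F_F := hFF
      inner_E_F := fun y hy j => by rw [real_inner_smul_left, hDF y hy, mul_zero]
      inner_E_JF := fun y hy j => by rw [real_inner_smul_left, hDJF y hy, mul_zero]
      inner_E_E := fun y hy j k => by
        rw [real_inner_smul_left, real_inner_smul_right]
        split_ifs with hjk
        · subst hjk
          have := (hf0 y hy j).ne'
          rw [real_inner_self_eq_norm_sq]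
          change (f j y)⁻¹ * ((f j y)⁻¹ * f j y ^ 2) = 1
          field_simp
        · rw [hDD y hy, horth y hy j k hjk, mul_zero, mul_zero]
      fderiv_F := fun y hy j => by
        rw [smul_smul, mul_inv_cancel₀ (hf0 y hy j).ne', one_smul]
        simp [hD] }
  exact frame.not_nonempty

end

/-- On the complex projective plane with a Fubini–Study metric, there is no orthogonal coordinate
system on any nonempty open set. -/
theorem proposition3p2 (c : ℝ) (hc : 0 < c) :
    ¬ ∃ x : OpenPartialHomeomorph (CP 2) (EuclideanSpace ℝ (Fin 4)),
      x.source.Nonempty ∧ IsOrthogonalCoordinateSystem (CP.fubiniStudyMetric 2 c hc) x := by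
  rintro ⟨x, ⟨p₀, hp₀⟩, hx⟩
  set φ := CP.affineChart (CP.idx p₀) with hφ
  set U : Set (EuclideanSpace ℝ (Fin 4)) := x.target ∩ x.symm ⁻¹' φ.source
  have hU : IsOpen U := x.symm.isOpen_inter_preimage φ.open_source
  have hne : U.Nonempty := ⟨x p₀, x.map_source hp₀, by
    simpa [x.left_inv hp₀] using CP.mem_idx_source p₀⟩
  have hatlas (p : CP 2) : ContMDiffOn 𝓘(ℝ, EuclideanSpace ℂ (Fin 2))
      𝓘(ℝ, EuclideanSpace ℂ (Fin 2)) ∞ (CP.affineChart (CP.idx p))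
      (CP.affineChart (CP.idx p)).source := contMDiffOn_chart (x := p)
  have hatlas_symm (p : CP 2) : ContMDiffOn 𝓘(ℝ, EuclideanSpace ℂ (Fin 2))
      𝓘(ℝ, EuclideanSpace ℂ (Fin 2)) ∞ (CP.affineChart (CP.idx p)).symm
      (CP.affineChart (CP.idx p)).target := contMDiffOn_chart_symm (x := p)
  set w : EuclideanSpace ℝ (Fin 4) → EuclideanSpace ℂ (Fin 2) := fun y => φ (x.symm y) with hw
  have hws : ContDiffOn ℝ ∞ w U := by
    rw [← contMDiffOn_iff_contDiffOn]
    exact (hatlas p₀).comp (hx.contMDiffOn_symm.mono Set.inter_subset_left) fun y hy => hy.2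
  have hinj (y) (hy : y ∈ U) (v : EuclideanSpace ℝ (Fin 4)) (hv : fderiv ℝ w y v = 0) : v = 0 := by
    have hg : DifferentiableAt ℝ (fun u => x (φ.symm u)) (w y) := by
      have h1 : ContMDiffAt 𝓘(ℝ, EuclideanSpace ℂ (Fin 2)) 𝓘(ℝ, EuclideanSpace ℝ (Fin 4)) ∞
          (fun u => x (φ.symm u)) (w y) := by
        have h2 : φ.symm (w y) = x.symm y := φ.left_inv hy.2
        refine ContMDiffAt.comp (w y) ?_ ((hatlas_symm p₀).contMDiffAt
          (φ.open_target.mem_nhds (φ.map_source hy.2)))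
        rw [h2]
        exact hx.contMDiffOn.contMDiffAt (x.open_source.mem_nhds (x.map_target hy.1))
      exact h1.contDiffAt.differentiableAt (by simp)
    have hcomp := hg.hasFDerivAt.comp y (hws.differentiableAt_of_isOpen hU hy).hasFDerivAt
    have hid : ((fun u => x (φ.symm u)) ∘ w) =ᶠ[nhds y] id := by
      filter_upwards [hU.mem_nhds hy] with t ht
      simp [hw, φ.left_inv ht.2, x.right_inv ht.1]
    have h3 := (hcomp.congr_of_eventuallyEq hid.symm).unique (hasFDerivAt_id y)
    have h4 := congrArg (fun L => L v) h3
    simpa [hv] using h4.symm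
  set e : Fin 4 → EuclideanSpace ℝ (Fin 4) := fun i => EuclideanSpace.single i (1 : ℝ) with he
  have hdz (y) (hy : y ∈ U) (i : Fin 4) :
      fderiv ℝ (fun y => CP.aff (CP.idx p₀) (w y)) y (e i) =
        CP.incl (CP.idx p₀) (fderiv ℝ w y (e i)) := by
    have := ((CP.hasFDerivAt_aff (CP.idx p₀) (w y)).comp y
      (hws.differentiableAt_of_isOpen hU hy).hasFDerivAt).fderiv
    exact congrArg (fun L => L (e i)) this
  refine CP.not_nonempty_of_fsForm_orthogonal hU e
    (z := fun y => CP.aff (CP.idx p₀) (w y)) ((CP.contDiff_aff _).comp_contDiffOn hws)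
    (fun y _ => CP.aff_ne_zero _ _) (fun y hy i => ?_) (fun y hy i j hij => ?_) hne
  · rw [hdz y hy]
    refine CP.fsForm_incl_pos _ _ _ fun h0 => ?_
    have := congrArg (fun v : EuclideanSpace ℝ (Fin 4) => v i) (hinj y hy _ h0)
    simp [he] at this
  · rw [hdz y hy, hdz y hy]
    set p := x.symm y with hp
    have hpq : φ.symm (w y) = p := φ.left_inv hy.2
    have hmem := CP.mem_idx_source p
    have hwi : CP.aff (CP.idx p₀) (w y) (CP.idx p) ≠ 0 := by
      rw [← CP.mk_mem_affineChart_source (CP.idx p) _ (CP.aff_ne_zero _ _), ← CP.affineChart_symm]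
      rw [← hφ, hpq]
      exact hmem
    have hr (t) (ht : t ∈ U) : CP.affineChart (CP.idx p) (x.symm t) =
        CP.ratio (CP.idx p) (CP.aff (CP.idx p₀) (w t)) := by
      rw [← CP.affineChart_mk (CP.idx p) _ (CP.aff_ne_zero _ _), ← CP.affineChart_symm, ← hφ]
      rw [hw, φ.left_inv ht.2]
    have hT : DifferentiableAt ℝ (fun u => CP.ratio (CP.idx p) (CP.aff (CP.idx p₀) u)) (w y) :=
      ((CP.contDiffAt_ratio _ hwi).comp (w y) (CP.contDiff_aff _).contDiffAt).differentiableAt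
        (by simp)
    have hcoord (i : Fin 4) : coordVector 𝓘(ℝ, EuclideanSpace ℂ (Fin 2)) x y i =
        fderiv ℝ (fun u => CP.ratio (CP.idx p) (CP.aff (CP.idx p₀) u)) (w y)
          (fderiv ℝ w y (e i)) := by
      have hmd : MDifferentiableAt 𝓘(ℝ, EuclideanSpace ℝ (Fin 4))
          𝓘(ℝ, EuclideanSpace ℂ (Fin 2)) x.symm y :=
        (hx.contMDiffOn_symm.contMDiffAt (x.open_target.mem_nhds hy.1)).mdifferentiableAt
          (by simp)
      have h1 := (hT.hasFDerivAt.comp y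
        (hws.differentiableAt_of_isOpen hU hy).hasFDerivAt).fderiv
      have h2 : fderiv ℝ (writtenInExtChartAt 𝓘(ℝ, EuclideanSpace ℝ (Fin 4))
          𝓘(ℝ, EuclideanSpace ℂ (Fin 2)) y x.symm) y =
          fderiv ℝ ((fun u => CP.ratio (CP.idx p) (CP.aff (CP.idx p₀) u)) ∘ w) y :=
        Set.EqOn.fderiv_eq_of_isOpen (U := U) (fun t ht => hr t ht) hU hy
      have h3 : fderivWithin ℝ (writtenInExtChartAt 𝓘(ℝ, EuclideanSpace ℝ (Fin 4))
          𝓘(ℝ, EuclideanSpace ℂ (Fin 2)) y x.symm) (Set.range 𝓘(ℝ, EuclideanSpace ℝ (Fin 4)))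
          (extChartAt 𝓘(ℝ, EuclideanSpace ℝ (Fin 4)) y y) =
          fderiv ℝ (writtenInExtChartAt 𝓘(ℝ, EuclideanSpace ℝ (Fin 4))
          𝓘(ℝ, EuclideanSpace ℂ (Fin 2)) y x.symm) y := by
        rw [modelWithCornersSelf_coe, Set.range_id, fderivWithin_univ,
          extChartAt_model_space_eq_id, PartialEquiv.refl_coe, id]
      exact congrArg
        (fun L : EuclideanSpace ℝ (Fin 4) →L[ℝ] EuclideanSpace ℂ (Fin 2) => L (e i))
        (hmd.mfderiv.trans (h3.trans (h2.trans h1)))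
    have ho := hx.orthogonal y hy.1 i j hij
    rw [hcoord, hcoord] at ho
    have ho' : 4 / c * CP.fsForm (CP.aff (CP.idx p) (CP.affineChart (CP.idx p) p))
      (CP.incl (CP.idx p) (fderiv ℝ (fun u => CP.ratio (CP.idx p) (CP.aff (CP.idx p₀) u)) (w y)
          (fderiv ℝ w y (e i))))
      (CP.incl (CP.idx p) (fderiv ℝ (fun u => CP.ratio (CP.idx p) (CP.aff (CP.idx p₀) u)) (w y)
          (fderiv ℝ w y (e j)))) = 0 := ho
    rw [hr y hy, CP.fsForm_transition _ _ _ hwi _ hT.hasFDerivAt] at ho'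
    exact (mul_eq_zero.1 ho').resolve_left (by positivity)
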